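/- Let $n\ge 1$ and $a,b\ge 0$ be integers, put $k=a+b$, and let $\Phi: M_n(\mathbb{C})\to M_n(\mathbb{C})^{\otimes a}\otimes M_n(\mathbb{C})^{\otimes b}$ be a $\mathbb{C}$-linear map. Let $e_{ij}$ be the matrix units of $M_n(\mathbb{C})$, and let $$C_\Phi=\sum_{i,j=1}^n e_{ij}\otimes\Phi(e_{ij})\in M_n(\mathbb{C})\otimes M_n(\mathbb{C})^{\otimes a}\otimes M_n(\mathbb{C})^{\otimes b}=M_n(\mathbb{C})^{\otimes(a+1)}\otimes M_n(\mathbb{C})^{\otimes b}$$ be the Choi matrix of $\Phi$. Let $\mathcal{U}_n\subset M_n(\mathbb{C})$ be the unitary group, $\overline{U}$ the entrywise complex conjugate of $U$, $\theta_n(A)=A^{t}$ the transpose map on $M_n(\mathbb{C})$, and $i_n$ the identity map of $M_n(\mathbb{C})$. For $\pi\in S_{k+1}$ let $\sigma_{k+1}(\pi)\in M_n(\mathbb{C})^{\otimes(k+1)}$ be the operator on $(\mathbb{C}^n)^{\otimes(k+1)}$ given by $\sigma_{k+1}(\pi)(v_1\otimes\cdots\otimes v_{k+1})=v_{\pi^{-1}(1)}\otimes\cdots\otimes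 v_{\pi^{-1}(k+1)}$. Then the following assertions are equivalent. (i) $\Phi$ is $(a,b)$-unitarily equivariant, that is, for all $U\in\mathcal{U}_n$ and all $X\in M_n(\mathbb{C})$, $$\Phi(UXU^*)=(\overline{U}^{\otimes a}\otimes U^{\otimes b})\,\Phi(X)\,(\overline{U}^{\otimes a}\otimes U^{\otimes b})^*.$$ (ii) $[C_\Phi,\ \overline{U}^{\otimes(a+1)}\otimes U^{\otimes b}]=0$ for all $U\in\mathcal{U}_n$. (iii) There exists a function $f:S_{k+1}\to\mathbb{C}$ such that $$C_\Phi=\sum_{\pi\in S_{k+1}}f(\pi)\,\bigl(\theta_n^{\otimes(a+1)}\otimes i_n^{\otimes b}\bigr)\bigl[\sigma_{k+1}(\pi)\bigr].$$ -/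

import Mathlib

open scoped Kronecker

namespace EquivariantMaps

/-- `M_n(ℂ)^{⊗a} ⊗ M_n(ℂ)^{⊗b}`, realised as the matrices indexed by multi-indices: a basis vector of
`(ℂⁿ)^{⊗a} ⊗ (ℂⁿ)^{⊗b}` is given by a pair of multi-indices, of lengths `a` and `b`. -/
abbrev TensorIndex (n a b : ℕ) : Type := (Fin a → Fin n) × (Fin b → Fin n)

/-- The elementary tensor `A₁ ⊗ ⋯ ⊗ A_m` in `M_n(ℂ)^{⊗m}`. -/
def tensorFamily {n m : ℕ} (A : Fin m → Matrix (Fin n) (Fin n) ℂ) :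
    Matrix (Fin m → Fin n) (Fin m → Fin n) ℂ :=
  Matrix.of fun x y => ∏ i, A i (x i) (y i)

/-- The tensor power `A^{⊗m}`. -/
def tensorPow {n : ℕ} (A : Matrix (Fin n) (Fin n) ℂ) (m : ℕ) :
    Matrix (Fin m → Fin n) (Fin m → Fin n) ℂ :=
  tensorFamily fun _ => A

/-- The elementary tensor `v₁ ⊗ ⋯ ⊗ v_m` in `(ℂⁿ)^{⊗m}`. -/
def tensorVec {n m : ℕ} (v : Fin m → Fin n → ℂ) : (Fin m → Fin n) → ℂ :=
  fun x => ∏ i, v i (x i)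

/-- The entrywise complex conjugate of a matrix. -/
def conjMatrix {n : ℕ} (U : Matrix (Fin n) (Fin n) ℂ) : Matrix (Fin n) (Fin n) ℂ :=
  U.map (starRingEnd ℂ)

/-- `Ū^{⊗a} ⊗ U^{⊗b}`. -/
def mixedPow {n : ℕ} (a b : ℕ) (U : Matrix (Fin n) (Fin n) ℂ) :
    Matrix (TensorIndex n a b) (TensorIndex n a b) ℂ :=
  tensorPow (conjMatrix U) a ⊗ₖ tensorPow U b

/-- `(a,b)`-unitary equivariance:
`Φ(U X U*) = (Ū^{⊗a} ⊗ U^{⊗b}) Φ(X) (Ū^{⊗a} ⊗ U^{⊗b})*` for all unitary `U` and all `X`. -/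
def IsUnitarilyEquivariant {n a b : ℕ}
    (Φ : Matrix (Fin n) (Fin n) ℂ →ₗ[ℂ] Matrix (TensorIndex n a b) (TensorIndex n a b) ℂ) : Prop :=
  ∀ U ∈ Matrix.unitaryGroup (Fin n) ℂ, ∀ X : Matrix (Fin n) (Fin n) ℂ,
    Φ (U * X * U.conjTranspose) = mixedPow a b U * Φ X * (mixedPow a b U).conjTranspose

/-- The unnormalised Bell vector `∑ᵢ eᵢ ⊗ eᵢ`. -/
def bellVec (n : ℕ) : Fin n × Fin n → ℂ := fun p => if p.1 = p.2 then 1 else 0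

/-- The unnormalised Bell density matrix `B B* = ∑ᵢⱼ eᵢⱼ ⊗ eᵢⱼ`. -/
def bellMatrix (n : ℕ) : Matrix (Fin n × Fin n) (Fin n × Fin n) ℂ :=
  Matrix.vecMulVec (bellVec n) (star (bellVec n))

/-- The map `id ⊗ Φ` on `M_n ⊗ M_n`: `Φ` is applied to each of the `n × n` blocks. -/
def idTensor {n : ℕ} {I : Type*} (Φ : Matrix (Fin n) (Fin n) ℂ →ₗ[ℂ] Matrix I I ℂ)
    (X : Matrix (Fin n × Fin n) (Fin n × Fin n) ℂ) : Matrix (Fin n × I) (Fin n × I) ℂ :=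
  Matrix.of fun p q => Φ (Matrix.of fun r s => X (p.1, r) (q.1, s)) p.2 q.2

/-- The Choi matrix `C_Φ = (id ⊗ Φ)(B B*)` in `M_n ⊗ M_I`. -/
def choiMatrix {n : ℕ} {I : Type*} (Φ : Matrix (Fin n) (Fin n) ℂ →ₗ[ℂ] Matrix I I ℂ) :
    Matrix (Fin n × I) (Fin n × I) ℂ :=
  idTensor Φ (bellMatrix n)

/-- The regrouping `ℂⁿ ⊗ ((ℂⁿ)^{⊗a} ⊗ (ℂⁿ)^{⊗b}) = (ℂⁿ)^{⊗(a+1)} ⊗ (ℂⁿ)^{⊗b}` on indices. The new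
leg is the first one. -/
def regroup (n a b : ℕ) : Fin n × TensorIndex n a b ≃ TensorIndex n (a + 1) b :=
  (Equiv.prodAssoc _ _ _).symm.trans
    ((Fin.consEquiv fun _ : Fin (a + 1) => Fin n).prodCongr (Equiv.refl _))

/-- The Choi matrix of `Φ : M_n → M_n^{⊗a} ⊗ M_n^{⊗b}`, as an element of
`M_n^{⊗(a+1)} ⊗ M_n^{⊗b}`. -/
def choi {n a b : ℕ}
    (Φ : Matrix (Fin n) (Fin n) ℂ →ₗ[ℂ] Matrix (TensorIndex n a b) (TensorIndex n a b) ℂ) :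
    Matrix (TensorIndex n (a + 1) b) (TensorIndex n (a + 1) b) ℂ :=
  Matrix.reindex (regroup n a b) (regroup n a b) (choiMatrix Φ)

/-- The matrix of the operator `σ_m(π)` on `(ℂⁿ)^{⊗m}`, given by
`σ_m(π)(v₁ ⊗ ⋯ ⊗ v_m) = v_{π⁻¹(1)} ⊗ ⋯ ⊗ v_{π⁻¹(m)}`: the multi-index `y` is sent to `y ∘ π⁻¹`. -/
def permMatrix (n : ℕ) {m : ℕ} (π : Equiv.Perm (Fin m)) :
    Matrix (Fin m → Fin n) (Fin m → Fin n) ℂ :=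
  Matrix.of fun x y => if x = y ∘ π.symm then 1 else 0

/-- The identification `M_n^{⊗(p+q)} = M_n^{⊗p} ⊗ M_n^{⊗q}` (first `p` legs, last `q` legs). -/
def splitLegs {n p q : ℕ} (X : Matrix (Fin (p + q) → Fin n) (Fin (p + q) → Fin n) ℂ) :
    Matrix (TensorIndex n p q) (TensorIndex n p q) ℂ :=
  Matrix.of fun x y => X (Fin.append x.1 x.2) (Fin.append y.1 y.2)

/-- The map `θ_n^{⊗p} ⊗ id^{⊗q}` on `M_n^{⊗p} ⊗ M_n^{⊗q}`, with `θ_n` the transpose: row and column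
multi-indices of the first `p` legs are exchanged. -/
def partialTranspose {n p q : ℕ} (X : Matrix (TensorIndex n p q) (TensorIndex n p q) ℂ) :
    Matrix (TensorIndex n p q) (TensorIndex n p q) ℂ :=
  Matrix.of fun x y => X (y.1, x.2) (x.1, y.2)

/-! The next facts show that the entrywise definitions above are the intended maps. -/

theorem choiMatrix_eq_sum {n : ℕ} {I : Type*}
    (Φ : Matrix (Fin n) (Fin n) ℂ →ₗ[ℂ] Matrix I I ℂ) :
    choiMatrix Φ = ∑ i, ∑ j, Matrix.single i j (1 : ℂ) ⊗ₖ Φ (Matrix.single i j 1) := by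
  ext ⟨i, x⟩ ⟨j, y⟩
  have hB : (Matrix.of fun r s => bellMatrix n (i, r) (j, s)) = Matrix.single i j (1 : ℂ) := by
    ext r s
    by_cases h1 : i = r <;> by_cases h2 : j = s <;>
      simp [bellMatrix, bellVec, Matrix.vecMulVec, Matrix.single, h1, h2]
  simp only [choiMatrix, idTensor, Matrix.of_apply, hB, Matrix.sum_apply,
    Matrix.kroneckerMap_apply, Matrix.single_apply]
  rw [Finset.sum_eq_single i, Finset.sum_eq_single j]
  · simp
  · intro k _ hk
    simp [hk]
  · simp
  · intro k _ hk
    simp [hk]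
  · simp

theorem permMatrix_mulVec_tensorVec {n m : ℕ} (π : Equiv.Perm (Fin m)) (v : Fin m → Fin n → ℂ) :
    (permMatrix n π).mulVec (tensorVec v) = tensorVec fun i => v (π.symm i) := by
  funext x
  have hx : ∀ y : Fin m → Fin n, x = y ∘ π.symm ↔ y = x ∘ π := by
    intro y
    constructor
    · rintro rfl
      funext i
      simp
    · rintro rfl
      funext i
      simp
  simp only [Matrix.mulVec, dotProduct, permMatrix, Matrix.of_apply, hx, tensorVec, ite_mul, one_mul,
    zero_mul, Finset.sum_ite_eq', Finset.mem_univ, if_true]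
  exact Fintype.prod_equiv π _ _ (by intro i; simp)

theorem tensorFamily_mulVec_tensorVec {n m : ℕ} (A : Fin m → Matrix (Fin n) (Fin n) ℂ)
    (v : Fin m → Fin n → ℂ) :
    (tensorFamily A).mulVec (tensorVec v) = tensorVec fun i => (A i).mulVec (v i) := by
  funext x
  simp only [Matrix.mulVec, dotProduct, tensorFamily, Matrix.of_apply, tensorVec,
    ← Finset.prod_mul_distrib]
  rw [Finset.prod_univ_sum]
  simp

theorem splitLegs_tensorFamily {n p q : ℕ} (A : Fin (p + q) → Matrix (Fin n) (Fin n) ℂ) :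
    splitLegs (tensorFamily A) =
      tensorFamily (fun i : Fin p => A (Fin.castAdd q i)) ⊗ₖ
        tensorFamily (fun j : Fin q => A (Fin.natAdd p j)) := by
  ext x y
  simp [splitLegs, tensorFamily, Fin.prod_univ_add, Matrix.kroneckerMap_apply]

theorem partialTranspose_tensorFamily {n p q : ℕ} (A : Fin p → Matrix (Fin n) (Fin n) ℂ)
    (B : Fin q → Matrix (Fin n) (Fin n) ℂ) :
    partialTranspose (tensorFamily A ⊗ₖ tensorFamily B) =
      tensorFamily (fun i => (A i).transpose) ⊗ₖ tensorFamily B := by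
  ext x y
  simp [partialTranspose, tensorFamily, Matrix.kroneckerMap_apply]

theorem regroup_tensorFamily {n a b : ℕ} (A₀ : Matrix (Fin n) (Fin n) ℂ)
    (A : Fin a → Matrix (Fin n) (Fin n) ℂ) (B : Fin b → Matrix (Fin n) (Fin n) ℂ) :
    Matrix.reindex (regroup n a b) (regroup n a b) (A₀ ⊗ₖ (tensorFamily A ⊗ₖ tensorFamily B)) =
      tensorFamily (Fin.cons A₀ A : Fin (a + 1) → Matrix (Fin n) (Fin n) ℂ) ⊗ₖ tensorFamily B := by
  ext x y
  simp [regroup, tensorFamily, Matrix.kroneckerMap_apply, Fin.prod_univ_succ, Fin.consEquiv,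
    Fin.tail, mul_assoc]

end EquivariantMaps

open scoped Kronecker

/-! (i) ⇔ (ii): on the Bell matrix, a factor acting on the first leg can be moved to the second as
its transpose. Conjugating `C_Φ` by `Ū ⊗ (Ū^{⊗a} ⊗ U^{⊗b})` therefore gives the Choi matrix of `X ↦
W Φ(U* X U) W*`, with `W = Ū^{⊗a} ⊗ U^{⊗b}`. A map is determined by its Choi matrix, so invariance
of `C_Φ` is equivariance of `Φ` (`commute_choi_mixedPow_iff`).

(ii) ⇔ (iii): partial transposition of the first `a + 1` legs turns each `Ū` into `U`
(`commute_partialTranspose_mixedPow_iff`), which reduces the claim to Schur–Weyl duality for the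
unitary group (`mem_span_permMatrix_of_commute`). There, `X` commuting with all `U^{⊗m}` is shown to
commute with every symmetrised elementary tensor. These span the commutant of the permutations, so
the double commutant theorem puts `X` in the span of the permutations. -/

namespace EquivariantMaps

/-! ### Double commutant of a finite group -/

/-- The double commutant theorem for a representation of a finite group: a matrix that commutes with
the commutant of `ρ` is a linear combination of the matrices `ρ g`. -/
theorem mem_span_range_of_commute_commutant {G I : Type*} [Group G] [Fintype G] [Fintype I]
    [DecidableEq I] (ρ : G →* Matrix I I ℂ) (X : Matrix I I ℂ)
    (hX : ∀ Y : Matrix I I ℂ, (∀ g, Commute (ρ g) Y) → Commute X Y) :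
    X ∈ Submodule.span ℂ (Set.range ρ) := by
  set S := Submodule.span ℂ (Set.range ρ) with hS
  -- `p` is any linear projection onto `S`. As in Maschke's theorem, averaging it over the group
  -- (without dividing by the order) makes it equivariant for left multiplication.
  obtain ⟨p, hp⟩ := LinearMap.exists_leftInverse_of_injective S.subtype S.ker_subtype
  have hmul : ∀ g, ∀ Z ∈ S, ρ g * Z ∈ S := by
    intro g Z hZ
    induction hZ using Submodule.span_induction with
    | mem Z hZ =>
      obtain ⟨h, rfl⟩ := hZ
      exact Submodule.subset_span ⟨g * h, map_mul ρ g h⟩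
    | zero => simp
    | add Z W _ _ hZ hW => rw [mul_add]; exact S.add_mem hZ hW
    | smul c Z _ hZ => rw [Matrix.mul_smul]; exact S.smul_mem c hZ
  let q : Matrix I I ℂ →ₗ[ℂ] Matrix I I ℂ :=
    ∑ g, LinearMap.mulLeft ℂ (ρ g) ∘ₗ S.subtype ∘ₗ p ∘ₗ LinearMap.mulLeft ℂ (ρ g⁻¹)
  have hq : ∀ Z, q Z = ∑ g, ρ g * (p (ρ g⁻¹ * Z) : Matrix I I ℂ) := fun Z => by
    simp [q, LinearMap.sum_apply]
  have hqS : ∀ Z, q Z ∈ S := fun Z => by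
    rw [hq]
    exact S.sum_mem fun g _ => hmul g _ (p _).2
  have hqρ : ∀ g Z, q (ρ g * Z) = ρ g * q Z := by
    intro g Z
    rw [hq, hq, Finset.mul_sum]
    refine Fintype.sum_equiv (Equiv.mulLeft g⁻¹) _ _ fun h => ?_
    simp [← mul_assoc, ← map_mul]
  have hρρ : ∀ g, ρ g * ρ g⁻¹ = 1 := fun g => by rw [← map_mul, mul_inv_cancel, map_one]
  have hq1 : q 1 = (Fintype.card G : ℂ) • (1 : Matrix I I ℂ) := by
    have : ∀ g, ρ g * (p (ρ g⁻¹ * 1) : Matrix I I ℂ) = 1 := by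
      intro g
      have h1 : ρ g⁻¹ ∈ S := Submodule.subset_span ⟨_, rfl⟩
      have h2 := LinearMap.congr_fun hp ⟨ρ g⁻¹, h1⟩
      simp only [LinearMap.comp_apply, Submodule.subtype_apply, LinearMap.id_apply] at h2
      rw [mul_one, h2, hρρ]
    rw [hq, Finset.sum_congr rfl fun g _ => this g, Finset.sum_const, Finset.card_univ,
      Nat.cast_smul_eq_nsmul]
  -- Seen as a map on tuples of columns, `q` has blocks `Y j k`, taking column `k` of the argument
  -- to column `j` of the value. Equivariance of `q` puts each block in the commutant of `ρ`, so `X`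
  -- passes through `q`, and `q X = X * q 1` is a multiple of `X` lying in `S`.
  let Y : I → I → Matrix I I ℂ := fun j k => Matrix.of fun i l => q (Matrix.single l k 1) i j
  have hY : ∀ (Z : Matrix I I ℂ) i j, q Z i j = ∑ k, (Y j k * Z) i k := by
    intro Z i j
    conv_lhs => rw [Matrix.matrix_eq_sum_single Z]
    simp only [map_sum, Matrix.sum_apply, Matrix.mul_apply, Y, Matrix.of_apply]
    rw [Finset.sum_comm]
    refine Finset.sum_congr rfl fun k _ => Finset.sum_congr rfl fun l _ => ?_
    have : Matrix.single l k (Z l k) = Z l k • Matrix.single l k (1 : ℂ) := by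
      simp [Matrix.smul_single]
    rw [this, map_smul, Matrix.smul_apply, smul_eq_mul, mul_comm]
  have hqcol : ∀ (A : Matrix I I ℂ) l k i j,
      q (A * Matrix.single l k 1) i j = (Y j k * A) i l := by
    intro A l k i j
    rw [hY, Finset.sum_eq_single k]
    · rw [← mul_assoc]; simp
    · intro k' _ hk
      rw [← mul_assoc, Matrix.mul_single_apply_of_ne (hbj := hk)]
    · simp
  have hcomm : ∀ j k g, Commute (ρ g) (Y j k) := by
    intro j k g
    ext i l
    rw [← hqcol, hqρ]
    simp [Matrix.mul_apply, Y]
  have hXq : q X = X * q 1 := by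
    ext i j
    rw [hY, Matrix.mul_apply]
    simp only [hY, Finset.mul_sum, mul_one]
    rw [Finset.sum_comm]
    refine Finset.sum_congr rfl fun k _ => ?_
    rw [← (hX _ (hcomm j k)).eq, Matrix.mul_apply]
  have hc : (Fintype.card G : ℂ) ≠ 0 := Nat.cast_ne_zero.2 Fintype.card_ne_zero
  have := S.smul_mem (Fintype.card G : ℂ)⁻¹ (hqS X)
  rwa [hXq, hq1, Matrix.mul_smul, mul_one, smul_smul, inv_mul_cancel₀ hc, one_smul] at this

/-! ### Permutation operators and elementary tensors -/

theorem permMatrix_mul_apply {n m : ℕ} (π : Equiv.Perm (Fin m))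
    (A : Matrix (Fin m → Fin n) (Fin m → Fin n) ℂ) (x y : Fin m → Fin n) :
    (permMatrix n π * A) x y = A (x ∘ π) y := by
  rw [Matrix.mul_apply, Finset.sum_eq_single (x ∘ π)]
  · simp [permMatrix, Function.comp_assoc]
  · rintro z - hz
    rw [permMatrix, Matrix.of_apply, if_neg, zero_mul]
    rintro rfl
    simp [Function.comp_assoc] at hz
  · simp

theorem mul_permMatrix_apply {n m : ℕ} (π : Equiv.Perm (Fin m))
    (A : Matrix (Fin m → Fin n) (Fin m → Fin n) ℂ) (x y : Fin m → Fin n) :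
    (A * permMatrix n π) x y = A x (y ∘ π.symm) := by
  simp [Matrix.mul_apply, permMatrix]

/-- The representation `σ_m` of the symmetric group on the tensor legs. -/
def permMatrixHom (n m : ℕ) :
    Equiv.Perm (Fin m) →* Matrix (Fin m → Fin n) (Fin m → Fin n) ℂ where
  toFun := permMatrix n
  map_one' := by
    ext x y
    simp [permMatrix, Matrix.one_apply, ← Equiv.Perm.inv_def]
  map_mul' π τ := by
    ext x y
    rw [permMatrix_mul_apply]
    have : x ∘ π = y ∘ τ.symm ↔ x = y ∘ (π * τ).symm := by
      rw [← Equiv.eq_comp_symm]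
      rfl
    simp only [permMatrix, Matrix.of_apply, this]

theorem tensorFamily_mul_permMatrix {n m : ℕ} (A : Fin m → Matrix (Fin n) (Fin n) ℂ)
    (π : Equiv.Perm (Fin m)) :
    tensorFamily A * permMatrix n π = permMatrix n π * tensorFamily (A ∘ π) := by
  ext x y
  rw [permMatrix_mul_apply, mul_permMatrix_apply]
  simp only [tensorFamily, Matrix.of_apply]
  exact (Fintype.prod_equiv π _ _ (by simp)).symm

theorem tensorFamily_mul {n m : ℕ} (A B : Fin m → Matrix (Fin n) (Fin n) ℂ) :
    tensorFamily A * tensorFamily B = tensorFamily fun i => A i * B i := by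
  ext x y
  simp only [tensorFamily, Matrix.mul_apply, Matrix.of_apply, ← Finset.prod_mul_distrib,
    Finset.prod_univ_sum, Fintype.piFinset_univ]

theorem tensorPow_mul {n : ℕ} (A B : Matrix (Fin n) (Fin n) ℂ) (m : ℕ) :
    tensorPow (A * B) m = tensorPow A m * tensorPow B m :=
  (tensorFamily_mul _ _).symm

theorem tensorPow_diagonal {n : ℕ} (d : Fin n → ℂ) (m : ℕ) :
    tensorPow (Matrix.diagonal d) m = Matrix.diagonal fun x : Fin m → Fin n => ∏ i, d (x i) := by
  ext x y
  rw [Matrix.diagonal_apply]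
  simp only [tensorPow, tensorFamily, Matrix.of_apply]
  split_ifs with h
  · simp [h]
  · obtain ⟨i, hi⟩ := Function.ne_iff.1 h
    exact Finset.prod_eq_zero (Finset.mem_univ i) (Matrix.diagonal_apply_ne _ hi)

/-! ### Polarisation -/

/-- The elementary tensor as a multilinear function of its factors. -/
def tensorFamilyMultilinear (n m : ℕ) :
    MultilinearMap ℂ (fun _ : Fin m => Matrix (Fin n) (Fin n) ℂ)
      (Matrix (Fin m → Fin n) (Fin m → Fin n) ℂ) where
  toFun := tensorFamily
  map_update_add' A i B C := by
    ext x y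
    have h : ∀ D : Matrix (Fin n) (Fin n) ℂ, ∀ j, Function.update A i D j (x j) (y j) =
        Function.update (fun j => A j (x j) (y j)) i (D (x i) (y i)) j := by
      intro D j
      rcases eq_or_ne j i with rfl | hj <;> simp [*]
    simp [tensorFamily, h, Finset.prod_update_of_mem, add_mul]
  map_update_smul' A i c B := by
    ext x y
    have h : ∀ D : Matrix (Fin n) (Fin n) ℂ, ∀ j, Function.update A i D j (x j) (y j) =
        Function.update (fun j => A j (x j) (y j)) i (D (x i) (y i)) j := by
      intro D j
      rcases eq_or_ne j i with rfl | hj <;> simp [*]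
    simp [tensorFamily, h, Finset.prod_update_of_mem, mul_assoc]

/-- The polarisation identity for tensor powers. -/
theorem sum_tensorFamily_comp_perm {n m : ℕ} (A : Fin m → Matrix (Fin n) (Fin n) ℂ) :
    ∑ π : Equiv.Perm (Fin m), tensorFamily (A ∘ π) =
      ∑ T : Finset (Fin m), (-1 : ℂ) ^ T.card • tensorPow (∑ j ∈ Tᶜ, A j) m := by
  ext x y
  simp only [Matrix.sum_apply, Matrix.smul_apply, tensorPow, tensorFamily, Matrix.of_apply,
    Finset.prod_univ_sum, smul_eq_mul, Finset.mul_sum, Function.comp_apply]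
  have h1 : ∀ T : Finset (Fin m),
      ∑ φ ∈ Fintype.piFinset (fun _ : Fin m => Tᶜ),
          (-1 : ℂ) ^ T.card * ∏ i, A (φ i) (x i) (y i) =
        ∑ φ : Fin m → Fin m, if T ⊆ (Finset.univ.image φ)ᶜ then
          (-1 : ℂ) ^ T.card * ∏ i, A (φ i) (x i) (y i) else 0 := by
    intro T
    rw [← Finset.sum_filter]
    refine Finset.sum_congr ?_ fun _ _ => rfl
    ext φ
    simp only [Fintype.mem_piFinset, Finset.mem_compl, Finset.mem_filter, Finset.mem_univ,
      true_and, Finset.subset_iff, Finset.mem_image, not_exists]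
    exact ⟨fun h t ht i hi => h i (hi ▸ ht), fun h i hi => h hi i rfl⟩
  rw [Finset.sum_congr rfl fun T _ => h1 T, Finset.sum_comm]
  -- Inclusion–exclusion over the sets `T` of values missed by `φ`: the alternating sum vanishes
  -- unless `φ` is surjective, hence a permutation.
  have h2 : ∀ φ : Fin m → Fin m,
      (∑ T : Finset (Fin m), if T ⊆ (Finset.univ.image φ)ᶜ then
          (-1 : ℂ) ^ T.card * ∏ i, A (φ i) (x i) (y i) else 0) =
        if Function.Surjective φ then ∏ i, A (φ i) (x i) (y i) else 0 := by
    intro φ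
    rw [← Finset.sum_filter, Finset.filter_subset_univ, ← Finset.sum_mul]
    have h3 := congrArg (Int.cast : ℤ → ℂ)
      (Finset.sum_powerset_neg_one_pow_card (x := (Finset.univ.image φ)ᶜ))
    push_cast at h3
    rw [h3]
    have h4 : (Finset.univ.image φ)ᶜ = ∅ ↔ Function.Surjective φ := by
      rw [Finset.compl_eq_empty_iff, Finset.eq_univ_iff_forall]
      simp [Function.Surjective]
    simp [h4]
  rw [Finset.sum_congr rfl fun φ _ => h2 φ]
  refine Fintype.sum_of_injective (fun π : Equiv.Perm (Fin m) => (π : Fin m → Fin m))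
    DFunLike.coe_injective _ _ ?_ ?_
  · intro φ hφ
    rw [if_neg]
    intro hs
    exact hφ ⟨Equiv.ofBijective φ (Finite.surjective_iff_bijective.1 hs), rfl⟩
  · intro π
    rw [if_pos π.surjective]

/-! ### Schur–Weyl duality for the unitary group -/

theorem prod_eq_prod_pow_card {n m : ℕ} (d : Fin n → ℂ) (x : Fin m → Fin n) :
    ∏ i, d (x i) = ∏ j, d j ^ (Finset.univ.filter fun i => x i = j).card := by
  rw [← Finset.prod_fiberwise' Finset.univ x d]
  simp

/-- Diagonal unitaries already force a nonzero entry `X x y` to join multi-indices in which each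
value occurs equally often, and on such pairs all diagonal tensor powers agree. -/
theorem commute_tensorPow_diagonal {n m : ℕ} {X : Matrix (Fin m → Fin n) (Fin m → Fin n) ℂ}
    (hX : ∀ U ∈ Matrix.unitaryGroup (Fin n) ℂ, Commute X (tensorPow U m)) (d : Fin n → ℂ) :
    Commute X (tensorPow (Matrix.diagonal d) m) := by
  rw [tensorPow_diagonal]
  ext x y
  rw [Matrix.mul_diagonal, Matrix.diagonal_mul, mul_comm]
  by_cases h0 : X x y = 0
  · simp [h0]
  congr 1
  rw [prod_eq_prod_pow_card, prod_eq_prod_pow_card]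
  refine Finset.prod_congr rfl fun j _ => ?_
  congr 1
  -- The multiplicity of `j` ranges over `0, …, m`, so order `m + 1` is what lets powers of `ζ` tell
  -- all of them apart.
  obtain ⟨ζ, hprim⟩ : ∃ ζ : ℂ, IsPrimitiveRoot ζ (m + 1) :=
    ⟨_, Complex.isPrimitiveRoot_exp _ m.succ_ne_zero⟩
  have hnorm : ζ * starRingEnd ℂ ζ = 1 := by
    have : ‖ζ‖ = 1 := hprim.norm'_eq_one m.succ_ne_zero
    rw [Complex.mul_conj, Complex.normSq_eq_norm_sq, this]
    simp
  have hU : Matrix.diagonal (Function.update 1 j ζ) ∈ Matrix.unitaryGroup (Fin n) ℂ := by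
    rw [Matrix.mem_unitaryGroup_iff, Matrix.star_eq_conjTranspose, Matrix.diagonal_conjTranspose,
      Matrix.diagonal_mul_diagonal, ← Matrix.diagonal_one]
    congr 1
    funext i
    rcases eq_or_ne i j with rfl | hi <;> simp [*]
  have hc := congrFun (congrFun (hX _ hU).eq x) y
  rw [tensorPow_diagonal, Matrix.mul_diagonal, Matrix.diagonal_mul, mul_comm] at hc
  have hp := mul_right_cancel₀ h0 hc
  have hprod : ∀ z : Fin m → Fin n, ∏ i, (Function.update 1 j ζ : Fin n → ℂ) (z i) =
      ζ ^ (Finset.univ.filter fun i => z i = j).card := by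
    intro z
    rw [prod_eq_prod_pow_card, Finset.prod_eq_single j]
    · simp
    · intro i _ hi
      simp [hi]
    · simp
  have hlt : ∀ z : Fin m → Fin n, (Finset.univ.filter fun i => z i = j).card < m + 1 := fun z =>
    Nat.lt_succ_of_le ((Finset.card_filter_le _ _).trans (by simp))
  rw [hprod, hprod] at hp
  exact hprim.pow_inj (hlt y) (hlt x) hp

theorem commute_tensorPow_of_isHermitian {n m : ℕ}
    {X : Matrix (Fin m → Fin n) (Fin m → Fin n) ℂ}
    (hX : ∀ U ∈ Matrix.unitaryGroup (Fin n) ℂ, Commute X (tensorPow U m))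
    {H : Matrix (Fin n) (Fin n) ℂ} (hH : H.IsHermitian) : Commute X (tensorPow H m) := by
  rw [hH.spectral_theorem, Unitary.conjStarAlgAut_apply, tensorPow_mul, tensorPow_mul]
  exact ((hX _ (SetLike.coe_mem _)).mul_right (commute_tensorPow_diagonal hX _)).mul_right
    (hX _ (Unitary.star_mem (SetLike.coe_mem _)))

/-- Polarisation handles Hermitian factors, since sums of these stay Hermitian. The general case
follows by multilinearity from the splitting into real and imaginary parts. -/
theorem commute_sum_tensorFamily_comp_perm {n m : ℕ}
    {X : Matrix (Fin m → Fin n) (Fin m → Fin n) ℂ}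
    (hX : ∀ U ∈ Matrix.unitaryGroup (Fin n) ℂ, Commute X (tensorPow U m))
    (A : Fin m → Matrix (Fin n) (Fin n) ℂ) :
    Commute X (∑ π : Equiv.Perm (Fin m), tensorFamily (A ∘ π)) := by
  let g : MultilinearMap ℂ (fun _ : Fin m => Matrix (Fin n) (Fin n) ℂ)
      (Matrix (Fin m → Fin n) (Fin m → Fin n) ℂ) :=
    (LinearMap.mulLeft ℂ X - LinearMap.mulRight ℂ X).compMultilinearMap
      (∑ π : Equiv.Perm (Fin m), (tensorFamilyMultilinear n m).domDomCongr π)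
  have hg : ∀ B, g B = X * (∑ π : Equiv.Perm (Fin m), tensorFamily (B ∘ π)) -
      (∑ π : Equiv.Perm (Fin m), tensorFamily (B ∘ π)) * X := by
    intro B
    simp only [g, LinearMap.compMultilinearMap_apply, LinearMap.sub_apply,
      LinearMap.mulLeft_apply, LinearMap.mulRight_apply, sum_apply,
      MultilinearMap.domDomCongr_apply]
    rfl
  have hherm : ∀ B : Fin m → Matrix (Fin n) (Fin n) ℂ, (∀ i, (B i).IsHermitian) → g B = 0 := by
    intro B hB
    rw [hg, sub_eq_zero, sum_tensorFamily_comp_perm]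
    refine Commute.sum_right _ _ _ fun T _ => Commute.smul_right ?_ _
    exact commute_tensorPow_of_isHermitian hX (isSelfAdjoint_sum _ fun i _ => hB i)
  suffices h : g A = 0 from sub_eq_zero.1 ((hg A).symm.trans h)
  have hA : A = (fun i => ((realPart (A i) : selfAdjoint _) : Matrix (Fin n) (Fin n) ℂ)) +
      fun i => Complex.I • ((imaginaryPart (A i) : selfAdjoint _) : Matrix (Fin n) (Fin n) ℂ) := by
    funext i
    exact (realPart_add_I_smul_imaginaryPart (A i)).symm
  rw [hA, MultilinearMap.map_add_univ]
  refine Finset.sum_eq_zero fun s _ => ?_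
  have hs : (s.piecewise
      (fun i => ((realPart (A i) : selfAdjoint _) : Matrix (Fin n) (Fin n) ℂ))
      fun i => Complex.I • ((imaginaryPart (A i) : selfAdjoint _) : Matrix (Fin n) (Fin n) ℂ)) =
      fun i => (if i ∈ s then (1 : ℂ) else Complex.I) •
        (if i ∈ s then ((realPart (A i) : selfAdjoint _) : Matrix (Fin n) (Fin n) ℂ)
          else ((imaginaryPart (A i) : selfAdjoint _) : Matrix (Fin n) (Fin n) ℂ)) := by
    funext i
    by_cases hi : i ∈ s <;> simp [hi]
  rw [hs, MultilinearMap.map_smul_univ, hherm, smul_zero]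
  intro i
  split_ifs
  · exact (realPart (A i)).2
  · exact (imaginaryPart (A i)).2

theorem tensorFamily_single {n m : ℕ} (x y : Fin m → Fin n) :
    tensorFamily (fun i => Matrix.single (x i) (y i) (1 : ℂ)) = Matrix.single x y 1 := by
  ext z w
  simp only [tensorFamily, Matrix.of_apply, Matrix.single_apply, Finset.prod_boole,
    Finset.mem_univ, true_imp_iff, forall_and, funext_iff]

/-- Schur–Weyl duality: the commutant of the tensor powers of the unitary matrices is spanned by the
permutations of the tensor legs. -/
theorem mem_span_permMatrix_of_commute {n m : ℕ}
    {X : Matrix (Fin m → Fin n) (Fin m → Fin n) ℂ}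
    (hX : ∀ U ∈ Matrix.unitaryGroup (Fin n) ℂ, Commute X (tensorPow U m)) :
    X ∈ Submodule.span ℂ (Set.range (permMatrix n (m := m))) := by
  refine mem_span_range_of_commute_commutant (permMatrixHom n m) X fun Y hY => ?_
  -- Averaging the expansion of `Y` in matrix units over conjugation by permutations, which fixes
  -- `Y`, replaces each unit by a symmetrised elementary tensor.
  have hsum : (Fintype.card (Equiv.Perm (Fin m)) : ℂ) • Y =
      ∑ x, ∑ y, Y x y • ∑ π : Equiv.Perm (Fin m),
        tensorFamily ((fun i => Matrix.single (x i) (y i) (1 : ℂ)) ∘ π) := by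
    have hconj : ∀ π : Equiv.Perm (Fin m), Y = ∑ x, ∑ y, Y x y •
        tensorFamily ((fun i => Matrix.single (x i) (y i) (1 : ℂ)) ∘ π) := by
      intro π
      have hinv : permMatrix n π⁻¹ * permMatrix n π = 1 := by
        have := map_mul (permMatrixHom n m) π⁻¹ π
        rw [inv_mul_cancel, map_one] at this
        exact this.symm
      have h1 : Y = permMatrix n π⁻¹ * (Y * permMatrix n π) := by
        rw [← show permMatrix n π * Y = Y * permMatrix n π from (hY π).eq, ← mul_assoc, hinv,
          one_mul]
      have h2 : ∀ A : Fin m → Matrix (Fin n) (Fin n) ℂ,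
          tensorFamily (A ∘ π) = permMatrix n π⁻¹ * (tensorFamily A * permMatrix n π) := by
        intro A
        rw [tensorFamily_mul_permMatrix, ← mul_assoc, hinv, one_mul]
      have h3 : Y = ∑ x, ∑ y, Y x y • Matrix.single x y (1 : ℂ) := by
        simpa [Matrix.smul_single] using Matrix.matrix_eq_sum_single Y
      calc Y = permMatrix n π⁻¹ *
            ((∑ x, ∑ y, Y x y • Matrix.single x y (1 : ℂ)) * permMatrix n π) := by rwa [← h3]
        _ = _ := by
          simp only [Finset.sum_mul, Finset.mul_sum, Matrix.smul_mul, Matrix.mul_smul, h2,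
            tensorFamily_single]
    simp only [Finset.smul_sum]
    rw [Nat.cast_smul_eq_nsmul, ← Finset.card_univ, ← Finset.sum_const,
      Finset.sum_congr rfl fun π _ => hconj π, Finset.sum_comm]
    exact Finset.sum_congr rfl fun x _ => Finset.sum_comm
  have hc : (Fintype.card (Equiv.Perm (Fin m)) : ℂ) ≠ 0 :=
    Nat.cast_ne_zero.2 Fintype.card_ne_zero
  rw [← inv_smul_smul₀ hc Y, hsum]
  refine Commute.smul_right (Commute.sum_right _ _ _ fun x _ => Commute.sum_right _ _ _ fun y _ =>
    Commute.smul_right (commute_sum_tensorFamily_comp_perm hX _) _) _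

/-! ### Partial transposition and mixed tensor powers -/

/-- Partial transposition is not multiplicative, but it transforms two-sided products well, so
commutation is handled as invariance under conjugation. -/
theorem commute_iff_conj_eq {I : Type*} [Fintype I] [DecidableEq I] {W : Matrix I I ℂ}
    (hW : W ∈ Matrix.unitaryGroup I ℂ) (Z : Matrix I I ℂ) :
    Commute Z W ↔ W * Z * W.conjTranspose = Z := by
  have h1 : W.conjTranspose * W = 1 := Matrix.mem_unitaryGroup_iff'.1 hW
  have h2 : W * W.conjTranspose = 1 := Matrix.mem_unitaryGroup_iff.1 hW
  constructor
  · intro h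
    rw [← h.eq, mul_assoc, h2, mul_one]
  · intro h
    change Z * W = W * Z
    conv_lhs => rw [← h]
    rw [mul_assoc, h1, mul_one]

theorem tensorPow_one (n m : ℕ) : tensorPow (1 : Matrix (Fin n) (Fin n) ℂ) m = 1 := by
  rw [← Matrix.diagonal_one, tensorPow_diagonal]
  simp

theorem tensorPow_conjTranspose {n : ℕ} (A : Matrix (Fin n) (Fin n) ℂ) (m : ℕ) :
    (tensorPow A m).conjTranspose = tensorPow A.conjTranspose m := by
  ext x y
  simp [tensorPow, tensorFamily, Matrix.conjTranspose_apply]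

theorem tensorPow_mem_unitaryGroup {n : ℕ} {U : Matrix (Fin n) (Fin n) ℂ}
    (hU : U ∈ Matrix.unitaryGroup (Fin n) ℂ) (m : ℕ) :
    tensorPow U m ∈ Matrix.unitaryGroup (Fin m → Fin n) ℂ := by
  rw [Matrix.mem_unitaryGroup_iff, Matrix.star_eq_conjTranspose] at *
  rw [tensorPow_conjTranspose, ← tensorPow_mul, hU, tensorPow_one]

theorem conjMatrix_conjTranspose {n : ℕ} (U : Matrix (Fin n) (Fin n) ℂ) :
    (conjMatrix U).conjTranspose = U.transpose := by
  ext i j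
  simp [conjMatrix, Matrix.conjTranspose_apply]

theorem conjMatrix_mem_unitaryGroup {n : ℕ} {U : Matrix (Fin n) (Fin n) ℂ}
    (hU : U ∈ Matrix.unitaryGroup (Fin n) ℂ) : conjMatrix U ∈ Matrix.unitaryGroup (Fin n) ℂ := by
  have h := congrArg Matrix.transpose (Matrix.mem_unitaryGroup_iff.1 hU)
  rw [Matrix.mem_unitaryGroup_iff, Matrix.star_eq_conjTranspose, conjMatrix_conjTranspose]
  rwa [Matrix.transpose_mul, Matrix.transpose_one] at h

theorem kronecker_mem_unitaryGroup {I J : Type*} [Fintype I] [DecidableEq I] [Fintype J]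
    [DecidableEq J] {A : Matrix I I ℂ} {B : Matrix J J ℂ} (hA : A ∈ Matrix.unitaryGroup I ℂ)
    (hB : B ∈ Matrix.unitaryGroup J ℂ) : A ⊗ₖ B ∈ Matrix.unitaryGroup (I × J) ℂ := by
  rw [Matrix.mem_unitaryGroup_iff, Matrix.star_eq_conjTranspose] at *
  rw [Matrix.conjTranspose_kronecker, ← Matrix.mul_kronecker_mul, hA, hB, Matrix.one_kronecker_one]

theorem mixedPow_mem_unitaryGroup {n : ℕ} {U : Matrix (Fin n) (Fin n) ℂ}
    (hU : U ∈ Matrix.unitaryGroup (Fin n) ℂ) (p q : ℕ) :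
    mixedPow p q U ∈ Matrix.unitaryGroup (TensorIndex n p q) ℂ :=
  kronecker_mem_unitaryGroup (tensorPow_mem_unitaryGroup (conjMatrix_mem_unitaryGroup hU) p)
    (tensorPow_mem_unitaryGroup hU q)

theorem partialTranspose_partialTranspose {n p q : ℕ}
    (X : Matrix (TensorIndex n p q) (TensorIndex n p q) ℂ) :
    partialTranspose (partialTranspose X) = X :=
  rfl

theorem partialTranspose_kronecker_mul_mul {n p q : ℕ}
    (A C : Matrix (Fin p → Fin n) (Fin p → Fin n) ℂ)
    (B D : Matrix (Fin q → Fin n) (Fin q → Fin n) ℂ)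
    (Z : Matrix (TensorIndex n p q) (TensorIndex n p q) ℂ) :
    partialTranspose ((A ⊗ₖ B) * Z * (C ⊗ₖ D)) =
      (C.transpose ⊗ₖ B) * partialTranspose Z * (A.transpose ⊗ₖ D) := by
  ext x y
  simp only [partialTranspose, Matrix.of_apply, Matrix.mul_apply, Matrix.kroneckerMap_apply,
    Matrix.transpose_apply, Finset.sum_mul]
  rw [← Fintype.sum_prod_type', ← Fintype.sum_prod_type']
  -- Transposing the first legs exchanges the first components of the two summation indices.
  let e : TensorIndex n p q × TensorIndex n p q ≃ TensorIndex n p q × TensorIndex n p q :=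
    { toFun := fun z => ((z.2.1, z.1.2), (z.1.1, z.2.2))
      invFun := fun z => ((z.2.1, z.1.2), (z.1.1, z.2.2))
      left_inv := fun _ => rfl
      right_inv := fun _ => rfl }
  refine Fintype.sum_equiv e _ _ fun z => ?_
  simp only [e, Equiv.coe_fn_mk]
  ring

theorem commute_partialTranspose_mixedPow_iff {n p q : ℕ} {U : Matrix (Fin n) (Fin n) ℂ}
    (hU : U ∈ Matrix.unitaryGroup (Fin n) ℂ)
    (Z : Matrix (TensorIndex n p q) (TensorIndex n p q) ℂ) :
    Commute (partialTranspose Z) (mixedPow p q U) ↔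
      Commute Z (tensorPow U p ⊗ₖ tensorPow U q) := by
  rw [commute_iff_conj_eq (mixedPow_mem_unitaryGroup hU p q),
    commute_iff_conj_eq (kronecker_mem_unitaryGroup (tensorPow_mem_unitaryGroup hU p)
      (tensorPow_mem_unitaryGroup hU q))]
  have h : mixedPow p q U * partialTranspose Z * (mixedPow p q U).conjTranspose =
      partialTranspose ((tensorPow U p ⊗ₖ tensorPow U q) * Z *
        (tensorPow U p ⊗ₖ tensorPow U q).conjTranspose) := by
    rw [Matrix.conjTranspose_kronecker, partialTranspose_kronecker_mul_mul, mixedPow,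
      Matrix.conjTranspose_kronecker]
    rw [tensorPow_conjTranspose, tensorPow_conjTranspose, conjMatrix_conjTranspose,
      tensorPow_conjTranspose]
    rfl
  rw [h]
  exact Function.Injective.eq_iff (Function.Involutive.injective partialTranspose_partialTranspose)

theorem commute_reindex_iff {I J : Type*} [Fintype I] [DecidableEq I] [Fintype J] [DecidableEq J]
    (e : I ≃ J) (A B : Matrix I I ℂ) :
    Commute (Matrix.reindex e e A) (Matrix.reindex e e B) ↔ Commute A B := by
  rw [← Matrix.coe_reindexAlgEquiv ℂ ℂ e]
  exact commute_map_iff (Matrix.reindexAlgEquiv ℂ ℂ e).injective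

/-- Multi-indices of length `p + q` are pairs of multi-indices of lengths `p` and `q`. -/
def splitIndex (n p q : ℕ) : (Fin (p + q) → Fin n) ≃ TensorIndex n p q :=
  (Fin.appendEquiv p q).symm

theorem splitLegs_eq_reindex {n p q : ℕ} (X : Matrix (Fin (p + q) → Fin n) (Fin (p + q) → Fin n) ℂ) :
    splitLegs X = Matrix.reindex (splitIndex n p q) (splitIndex n p q) X :=
  rfl

theorem splitLegs_tensorPow {n : ℕ} (U : Matrix (Fin n) (Fin n) ℂ) (p q : ℕ) :
    splitLegs (tensorPow U (p + q)) = tensorPow U p ⊗ₖ tensorPow U q :=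
  splitLegs_tensorFamily _

theorem partialTranspose_splitLegs_sum {n p q : ℕ} {ι : Type*} [Fintype ι] (f : ι → ℂ)
    (X : ι → Matrix (Fin (p + q) → Fin n) (Fin (p + q) → Fin n) ℂ) :
    partialTranspose (splitLegs (∑ i, f i • X i)) =
      ∑ i, f i • partialTranspose (splitLegs (X i)) := by
  ext x y
  simp [partialTranspose, splitLegs, Matrix.sum_apply]

/-- Schur–Weyl duality for mixed tensor powers: the commutant of the matrices `Ū^{⊗p} ⊗ U^{⊗q}`
consists of the combinations of partially transposed permutations. -/
theorem forall_commute_mixedPow_iff {n p q : ℕ}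
    (C : Matrix (TensorIndex n p q) (TensorIndex n p q) ℂ) :
    (∀ U ∈ Matrix.unitaryGroup (Fin n) ℂ, Commute C (mixedPow p q U)) ↔
      ∃ f : Equiv.Perm (Fin (p + q)) → ℂ,
        C = ∑ π, f π • partialTranspose (splitLegs (permMatrix n π)) := by
  constructor
  · intro h
    set X := Matrix.reindex (splitIndex n p q).symm (splitIndex n p q).symm (partialTranspose C)
      with hXdef
    have hsX : partialTranspose (splitLegs X) = C := by
      rw [splitLegs_eq_reindex, hXdef, ← Matrix.reindex_symm, Equiv.apply_symm_apply,
        partialTranspose_partialTranspose]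
    have hX : ∀ U ∈ Matrix.unitaryGroup (Fin n) ℂ, Commute X (tensorPow U (p + q)) := by
      intro U hU
      rw [← commute_reindex_iff (splitIndex n p q), ← splitLegs_eq_reindex,
        ← splitLegs_eq_reindex, splitLegs_tensorPow, ← commute_partialTranspose_mixedPow_iff hU,
        hsX]
      exact h U hU
    obtain ⟨f, hf⟩ := (Submodule.mem_span_range_iff_exists_fun ℂ).1
      (mem_span_permMatrix_of_commute hX)
    exact ⟨f, by rw [← partialTranspose_splitLegs_sum, hf, hsX]⟩
  · rintro ⟨f, rfl⟩ U hU
    refine Commute.sum_left _ _ _ fun π _ => Commute.smul_left ?_ _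
    rw [commute_partialTranspose_mixedPow_iff hU, ← splitLegs_tensorPow, splitLegs_eq_reindex,
      splitLegs_eq_reindex, commute_reindex_iff]
    exact (tensorFamily_mul_permMatrix (fun _ => U) π).symm

/-! ### Choi matrices and equivariance -/

theorem map_eq_sum_single {n : ℕ} {M : Type*} [AddCommMonoid M] [Module ℂ M]
    (Φ : Matrix (Fin n) (Fin n) ℂ →ₗ[ℂ] M) (X : Matrix (Fin n) (Fin n) ℂ) :
    Φ X = ∑ i, ∑ j, X i j • Φ (Matrix.single i j 1) := by
  conv_lhs => rw [Matrix.matrix_eq_sum_single X]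
  simp only [map_sum, ← map_smul, Matrix.smul_single, smul_eq_mul, mul_one]

theorem choiMatrix_apply {n : ℕ} {I : Type*}
    (Φ : Matrix (Fin n) (Fin n) ℂ →ₗ[ℂ] Matrix I I ℂ) (i j : Fin n) (x y : I) :
    choiMatrix Φ (i, x) (j, y) = Φ (Matrix.single i j 1) x y := by
  rw [choiMatrix_eq_sum]
  simp only [Matrix.sum_apply, Matrix.kroneckerMap_apply, Matrix.single_apply]
  rw [Finset.sum_eq_single i, Finset.sum_eq_single j] <;> simp +contextual

theorem choiMatrix_injective {n : ℕ} {I : Type*} :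
    Function.Injective (choiMatrix (n := n) (I := I)) := by
  intro Φ Ψ h
  ext1 X
  rw [map_eq_sum_single Φ, map_eq_sum_single Ψ]
  refine Finset.sum_congr rfl fun i _ => Finset.sum_congr rfl fun j _ => ?_
  congr 1
  ext x y
  rw [← choiMatrix_apply, ← choiMatrix_apply, h]

theorem kronecker_mul_choiMatrix_mul {n : ℕ} {I : Type*} [Fintype I]
    (Φ : Matrix (Fin n) (Fin n) ℂ →ₗ[ℂ] Matrix I I ℂ) (A B : Matrix (Fin n) (Fin n) ℂ)
    (V W : Matrix I I ℂ) :
    (A ⊗ₖ V) * choiMatrix Φ * (B ⊗ₖ W) =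
      choiMatrix (LinearMap.mulLeft ℂ V ∘ₗ LinearMap.mulRight ℂ W ∘ₗ Φ ∘ₗ
        LinearMap.mulLeft ℂ A.transpose ∘ₗ LinearMap.mulRight ℂ B.transpose) := by
  ext ⟨i, x⟩ ⟨j, y⟩
  rw [choiMatrix_apply, choiMatrix_eq_sum]
  simp only [Finset.mul_sum, Finset.sum_mul, ← Matrix.mul_kronecker_mul, LinearMap.comp_apply,
    LinearMap.mulLeft_apply, LinearMap.mulRight_apply]
  rw [map_eq_sum_single Φ]
  simp only [Finset.mul_sum, Finset.sum_mul, Matrix.sum_apply, Matrix.kroneckerMap_apply,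
    Matrix.smul_mul, Matrix.mul_smul, Matrix.smul_apply, smul_eq_mul, ← mul_assoc]
  refine Finset.sum_congr rfl fun k _ => Finset.sum_congr rfl fun l _ => ?_
  congr 1
  rw [Matrix.mul_assoc, Matrix.mul_assoc]
  simp [Matrix.mul_apply, Matrix.single_apply, ite_and, mul_comm]

theorem mixedPow_succ {n : ℕ} (a b : ℕ) (U : Matrix (Fin n) (Fin n) ℂ) :
    mixedPow (a + 1) b U = Matrix.reindex (regroup n a b) (regroup n a b)
      (conjMatrix U ⊗ₖ mixedPow a b U) := by
  rw [mixedPow, mixedPow, tensorPow, tensorPow, tensorPow, regroup_tensorFamily]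
  congr 2
  funext i
  refine Fin.cases ?_ (fun _ => ?_) i <;> rfl

theorem commute_choi_mixedPow_iff {n a b : ℕ}
    (Φ : Matrix (Fin n) (Fin n) ℂ →ₗ[ℂ] Matrix (TensorIndex n a b) (TensorIndex n a b) ℂ)
    {U : Matrix (Fin n) (Fin n) ℂ} (hU : U ∈ Matrix.unitaryGroup (Fin n) ℂ) :
    Commute (choi Φ) (mixedPow (a + 1) b U) ↔ ∀ X : Matrix (Fin n) (Fin n) ℂ,
      Φ (U * X * U.conjTranspose) = mixedPow a b U * Φ X * (mixedPow a b U).conjTranspose := by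
  have h1 : U.conjTranspose * U = 1 := Matrix.mem_unitaryGroup_iff'.1 hU
  have h2 : U * U.conjTranspose = 1 := Matrix.mem_unitaryGroup_iff.1 hU
  have hA : (conjMatrix U).transpose = U.conjTranspose := rfl
  have hB : (conjMatrix U).conjTranspose.transpose = U := by
    rw [conjMatrix_conjTranspose, Matrix.transpose_transpose]
  rw [choi, mixedPow_succ, commute_reindex_iff, commute_iff_conj_eq
    (kronecker_mem_unitaryGroup (conjMatrix_mem_unitaryGroup hU) (mixedPow_mem_unitaryGroup hU a b)),
    Matrix.conjTranspose_kronecker, kronecker_mul_choiMatrix_mul, choiMatrix_injective.eq_iff,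
    hA, hB, LinearMap.ext_iff]
  simp only [LinearMap.comp_apply, LinearMap.mulLeft_apply, LinearMap.mulRight_apply]
  -- The Choi side reads `W Φ(U* X U) W* = Φ X`; the two forms differ by replacing `X` with `U X U*`
  -- or `U* X U`.
  constructor
  · intro h X
    rw [← h, ← mul_assoc]
    congr 3
    rw [← mul_assoc, ← mul_assoc, ← mul_assoc, h1, one_mul, mul_assoc, h1, mul_one]
  · intro h X
    rw [← mul_assoc, ← h]
    congr 1
    rw [← mul_assoc, ← mul_assoc, h2, one_mul, mul_assoc, h2, mul_one]

end EquivariantMaps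

/-- The three conditions are equivalent. With `k = a + b`, the symmetric group `S_{k+1}` is realised
as the permutations of the `a + 1 + b` tensor legs. -/
theorem mainTheorem4 (n a b : ℕ)
    (Φ : Matrix (Fin n) (Fin n) ℂ →ₗ[ℂ]
      Matrix (EquivariantMaps.TensorIndex n a b) (EquivariantMaps.TensorIndex n a b) ℂ) :
    List.TFAE [
      EquivariantMaps.IsUnitarilyEquivariant Φ,
      ∀ U ∈ Matrix.unitaryGroup (Fin n) ℂ,
        ⁅EquivariantMaps.choi Φ, EquivariantMaps.mixedPow (a + 1) b U⁆ = 0,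
      ∃ f : Equiv.Perm (Fin (a + 1 + b)) → ℂ,
        EquivariantMaps.choi Φ =
          ∑ π : Equiv.Perm (Fin (a + 1 + b)),
            f π • EquivariantMaps.partialTranspose
              (EquivariantMaps.splitLegs (EquivariantMaps.permMatrix n π))] := by
  tfae_have 1 ↔ 2 := by
    refine forall₂_congr fun U hU => ?_
    rw [← commute_iff_lie_eq, EquivariantMaps.commute_choi_mixedPow_iff Φ hU]
  tfae_have 2 ↔ 3 := by
    rw [← EquivariantMaps.forall_commute_mixedPow_iff]
    exact forall₂_congr fun U _ => commute_iff_lie_eq.symm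
  tfae_finish
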